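/- Consider the call-by-value $\lambda$-calculus with shift and reset, with terms (up to $\alpha$-conversion) $t ::= x \mid \lambda x.t \mid t\,t \mid \mathcal{S}k.t \mid \langle t\rangle$, values $v ::= \lambda x.t$, pure contexts $E ::= \square \mid v\,E \mid E\,t$ and evaluation contexts $F ::= \square \mid v\,F \mid F\,t \mid \langle F\rangle$. Reduction $\to$ is given by $F[(\lambda x.t)\,v]\to F[t\{v/x\}]$, $F[\langle E[\mathcal{S}k.t]\rangle]\to F[\langle t\{\lambda x.\langle E[x]\rangle/k\}\rangle]$ ($x$ not free in $E$) and $F[\langle v\rangle]\to F[v]$; $\to^*$ is its reflexive transitive closure. A program $p$ is a term of the form $\langle t\rangle$. An environment $\mathcal{E}$ is a relation on closed values. Write $\widehat{\mathcal{E}}$ for the closure of $\mathcal{E}$ under all term constructors (with each variable related to itself), restricted to closed terms. Evaluation contexts are related by $\widehat{\mathcal{E}}$ when they have the same shape and their corresponding values and terms are related by $\widehat{\mathcal{E}}$. An environmental relation $\mathcal{X}$ is a set of environments and of triples $(\mathcal{E},t_0,t_1)$ with $t_0,t_1$ closed. It is an environmental bisimulation for programs if: (1) if $(\mathcal{E},t_0,t_1)\in\mathcal{X}$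 and $t_0,t_1$ are not both programs, then $(\mathcal{E},\langle E_0[t_0]\rangle,\langle E_1[t_1]\rangle)\in\mathcal{X}$ for all pure contexts $E_0,E_1$ related by $\widehat{\mathcal{E}}$; (2) if $(\mathcal{E},p_0,p_1)\in\mathcal{X}$ with $p_0,p_1$ programs, then (a) if $p_0\to p_0'$ with $p_0'$ a program, there is a program $p_1'$ with $p_1\to^* p_1'$ and $(\mathcal{E},p_0',p_1')\in\mathcal{X}$, (b) if $p_0\to v_0$ with $v_0$ a value, there is a value $v_1$ with $p_1\to^* v_1$ and $\mathcal{E}\cup\{(v_0,v_1)\}\in\mathcal{X}$, and (c) the converse conditions hold with the roles of $p_0$ and $p_1$ exchanged; (3) if $\mathcal{E}\in\mathcal{X}$, $(\lambda x.t_0)\mathrel{\mathcal{E}}(\lambda x.t_1)$ and $v_0,v_1$ are values with $v_0\mathrel{\widehat{\mathcal{E}}}v_1$, then $(\mathcal{E},t_0\{v_0/x\},t_1\{v_1/x\})\in\mathcal{X}$. Let $\simeq_p$ be the largest environmental bisimulation for programs taken at the empty environment: for closed terms, $t_0\simeq_p t_1$ iff $(\emptyset,t_0,t_1)$ belongs to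 some environmental bisimulation for programs. Its open extension $\simeq_p^\circ$ relates terms $t_0,t_1$ when $\lambda x_1\ldots x_n.t_0\simeq_p\lambda x_1\ldots x_n.t_1$, where $x_1,\ldots,x_n$ enumerates, in any order and without repetition, the variables that are free in $t_0$ or in $t_1$. **Lemma.** For every term $t$ and variable $k$, if $k$ is not free in $t$, then $t\simeq_p^\circ\mathcal{S}k.(k\,t)$. -/

import Mathlib

namespace LamShift

/-- Terms of the call-by-value lambda-calculus with shift and reset, up to alpha-conversion, in
locally nameless form: free variables are names (natural numbers), bound variables are de Bruijn
indices. The terms of the calculus are the locally closed ones (`Tm.LC`). -/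
inductive Tm : Type
  | bvar (i : ℕ) : Tm
  | fvar (x : ℕ) : Tm
  | lam (body : Tm) : Tm
  | app (t u : Tm) : Tm
  | shift (body : Tm) : Tm
  | reset (t : Tm) : Tm

namespace Tm

/-- All bound-variable indices are below `d` plus the number of enclosing binders. -/
def LCAt : ℕ → Tm → Prop
  | d, bvar i => i < d
  | _, fvar _ => True
  | d, lam b => LCAt (d + 1) b
  | d, app t u => LCAt d t ∧ LCAt d u
  | d, shift b => LCAt (d + 1) b
  | d, reset t => LCAt d t

/-- Locally closed: no dangling index. -/
def LC (t : Tm) : Prop := LCAt 0 t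

/-- Free variables. -/
def fv : Tm → Finset ℕ
  | bvar _ => ∅
  | fvar x => {x}
  | lam b => fv b
  | app t u => fv t ∪ fv u
  | shift b => fv b
  | reset t => fv t

/-- A closed term: a genuine (locally closed) term without free variables. -/
def Closed (t : Tm) : Prop := t.LC ∧ t.fv = ∅

/-- `close x d t` turns the free variable `x` into the bound variable of the `d`-th binder
around `t`. -/
def close (x : ℕ) : ℕ → Tm → Tm
  | _, bvar i => bvar i
  | d, fvar y => if y = x then bvar d else fvar y
  | d, lam b => lam (close x (d + 1) b)
  | d, app t u => app (close x d t) (close x d u)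
  | d, shift b => shift (close x (d + 1) b)
  | d, reset t => reset (close x d t)

/-- The named abstraction `λ x. t`. -/
def abs (x : ℕ) (t : Tm) : Tm := lam (close x 0 t)

/-- The named capture operator `S k. t`. -/
def capture (k : ℕ) (t : Tm) : Tm := shift (close k 0 t)

/-- The iterated abstraction `λ x₁ ... xₙ. t`. -/
def absList (xs : List ℕ) (t : Tm) : Tm := xs.foldr abs t

/-- `subst d u b` replaces the variable bound by the `d`-th binder around `b` by `u`. If `u` is
locally closed, then `subst 0 u b` is the result of the capture-avoiding substitution of `u` for
the bound variable in the body `b` of `lam b` or `shift b`. -/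
def subst : ℕ → Tm → Tm → Tm
  | d, u, bvar i => if i = d then u else bvar i
  | _, _, fvar y => fvar y
  | d, u, lam b => lam (subst (d + 1) u b)
  | d, u, app s t => app (subst d u s) (subst d u t)
  | d, u, shift b => shift (subst (d + 1) u b)
  | d, u, reset t => reset (subst d u t)

/-- Values are the abstractions. -/
def IsValue (t : Tm) : Prop := ∃ b, t = lam b

/-- Programs are the terms of the form `⟨t⟩`. -/
def IsProgram (t : Tm) : Prop := ∃ s, t = reset s

end Tm

/-- Call-by-value evaluation contexts `F ::= □ | v F | F t | ⟨F⟩`; `vapp b F` is the context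
`v F` where `v` is the value `lam b`. -/
inductive ECtx : Type
  | hole : ECtx
  | vapp (b : Tm) (F : ECtx) : ECtx
  | appt (F : ECtx) (t : Tm) : ECtx
  | reset (F : ECtx) : ECtx

namespace ECtx

/-- Filling the hole. -/
def fill : ECtx → Tm → Tm
  | hole, s => s
  | vapp b F, s => Tm.app (Tm.lam b) (F.fill s)
  | appt F t, s => Tm.app (F.fill s) t
  | reset F, s => Tm.reset (F.fill s)

/-- Pure contexts `E ::= □ | v E | E t`: the evaluation contexts without a reset. -/
def IsPure : ECtx → Prop
  | hole => True
  | vapp _ F => F.IsPure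
  | appt F _ => F.IsPure
  | reset _ => False

end ECtx

/-- One-step call-by-value reduction of (locally closed) terms. As the context `E` has no dangling
index, `lam ⟨E[bvar 0]⟩` is `λ x. ⟨E[x]⟩` with `x` fresh. -/
inductive Step : Tm → Tm → Prop
  | beta (F : ECtx) (b v : Tm) (hv : v.IsValue) :
      Step (F.fill (Tm.app (Tm.lam b) v)) (F.fill (Tm.subst 0 v b))
  | shift (F E : ECtx) (hE : E.IsPure) (b : Tm) :
      Step (F.fill (Tm.reset (E.fill (Tm.shift b))))
        (F.fill (Tm.reset (Tm.subst 0 (Tm.lam (Tm.reset (E.fill (Tm.bvar 0)))) b)))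
  | reset (F : ECtx) (v : Tm) (hv : v.IsValue) :
      Step (F.fill (Tm.reset v)) (F.fill v)

/-- Reflexive and transitive closure of reduction. -/
abbrev Steps : Tm → Tm → Prop := Relation.ReflTransGen Step

/-- The term generating closure of a relation (used for relations on closed terms). -/
inductive TermClosure (R : Tm → Tm → Prop) : Tm → Tm → Prop
  | base {t t' : Tm} : R t t' → TermClosure R t t'
  | bvar (i : ℕ) : TermClosure R (Tm.bvar i) (Tm.bvar i)
  | fvar (x : ℕ) : TermClosure R (Tm.fvar x) (Tm.fvar x)
  | lam {b b' : Tm} : TermClosure R b b' → TermClosure R (Tm.lam b) (Tm.lam b')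
  | app {t t' u u' : Tm} : TermClosure R t t' → TermClosure R u u' →
      TermClosure R (Tm.app t u) (Tm.app t' u')
  | shift {b b' : Tm} : TermClosure R b b' → TermClosure R (Tm.shift b) (Tm.shift b')
  | reset {t t' : Tm} : TermClosure R t t' → TermClosure R (Tm.reset t) (Tm.reset t')

/-- The restriction of the term generating closure to closed terms. -/
def ClosedTermClosure (R : Tm → Tm → Prop) (t t' : Tm) : Prop :=
  TermClosure R t t' ∧ t.Closed ∧ t'.Closed

/-- The context generating closure of a relation, on closed evaluation contexts. -/
inductive CtxClosure (R : Tm → Tm → Prop) : ECtx → ECtx → Prop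
  | hole : CtxClosure R ECtx.hole ECtx.hole
  | vapp {b b' : Tm} {F F' : ECtx} : CtxClosure R F F' →
      ClosedTermClosure R (Tm.lam b) (Tm.lam b') →
      CtxClosure R (ECtx.vapp b F) (ECtx.vapp b' F')
  | appt {F F' : ECtx} {t t' : Tm} : CtxClosure R F F' → ClosedTermClosure R t t' →
      CtxClosure R (ECtx.appt F t) (ECtx.appt F' t')
  | reset {F F' : ECtx} : CtxClosure R F F' → CtxClosure R (ECtx.reset F) (ECtx.reset F')

/-- An environment (for programs) is a relation on closed values. -/
def IsEnv (env : Tm → Tm → Prop) : Prop :=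
  ∀ v v', env v v' → (v.IsValue ∧ v.Closed) ∧ (v'.IsValue ∧ v'.Closed)

/-- The environment `{(v, v')} ∪ env`. -/
def extend (env : Tm → Tm → Prop) (v v' : Tm) : Tm → Tm → Prop :=
  fun w w' => (w = v ∧ w' = v') ∨ env w w'

/-- An environmental relation: a set of environments together with a set of triples
`(env, t₀, t₁)` where `t₀` and `t₁` are closed. -/
structure EnvRel where
  /-- The environments that belong to the relation. -/
  envs : (Tm → Tm → Prop) → Prop
  /-- The triples that belong to the relation. -/
  triples : (Tm → Tm → Prop) → Tm → Tm → Prop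
  envs_isEnv : ∀ env, envs env → IsEnv env
  triples_wf : ∀ env t₀ t₁, triples env t₀ t₁ → IsEnv env ∧ t₀.Closed ∧ t₁.Closed

/-- Environmental bisimulations for programs. -/
structure IsProgramBisimulation (X : EnvRel) : Prop where
  /-- Terms that are not both programs are tested in related pure contexts within a reset. -/
  test : ∀ env t₀ t₁, X.triples env t₀ t₁ → ¬ (t₀.IsProgram ∧ t₁.IsProgram) →
    ∀ E₀ E₁ : ECtx, E₀.IsPure → E₁.IsPure → CtxClosure env E₀ E₁ →
      X.triples env (Tm.reset (E₀.fill t₀)) (Tm.reset (E₁.fill t₁))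
  step_left : ∀ env p₀ p₁, X.triples env p₀ p₁ → p₀.IsProgram → p₁.IsProgram →
    ∀ p₀', p₀'.IsProgram → Step p₀ p₀' →
      ∃ p₁', p₁'.IsProgram ∧ Steps p₁ p₁' ∧ X.triples env p₀' p₁'
  value_left : ∀ env p₀ p₁, X.triples env p₀ p₁ → p₀.IsProgram → p₁.IsProgram →
    ∀ v₀, v₀.IsValue → Step p₀ v₀ →
      ∃ v₁, v₁.IsValue ∧ Steps p₁ v₁ ∧ X.envs (extend env v₀ v₁)
  step_right : ∀ env p₀ p₁, X.triples env p₀ p₁ → p₀.IsProgram → p₁.IsProgram →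
    ∀ p₁', p₁'.IsProgram → Step p₁ p₁' →
      ∃ p₀', p₀'.IsProgram ∧ Steps p₀ p₀' ∧ X.triples env p₀' p₁'
  value_right : ∀ env p₀ p₁, X.triples env p₀ p₁ → p₀.IsProgram → p₁.IsProgram →
    ∀ v₁, v₁.IsValue → Step p₁ v₁ →
      ∃ v₀, v₀.IsValue ∧ Steps p₀ v₀ ∧ X.envs (extend env v₀ v₁)
  /-- Related abstractions are tested with related arguments built from the environment. -/
  apply : ∀ env, X.envs env → ∀ b₀ b₁, env (Tm.lam b₀) (Tm.lam b₁) →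
    ∀ v₀ v₁, v₀.IsValue → v₁.IsValue → ClosedTermClosure env v₀ v₁ →
      X.triples env (Tm.subst 0 v₀ b₀) (Tm.subst 0 v₁ b₁)

/-- Environmental bisimilarity for programs: the union of all environmental bisimulations for
programs. -/
def programBisimilarity : EnvRel where
  envs env := ∃ X : EnvRel, IsProgramBisimulation X ∧ X.envs env
  triples env t₀ t₁ := ∃ X : EnvRel, IsProgramBisimulation X ∧ X.triples env t₀ t₁
  envs_isEnv := fun env ⟨X, _, h⟩ => X.envs_isEnv env h
  triples_wf := fun env t₀ t₁ ⟨X, _, h⟩ => X.triples_wf env t₀ t₁ h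

/-- Program bisimilarity is itself an environmental bisimulation for programs, hence the largest
one. -/
theorem programBisimilarity_isProgramBisimulation :
    IsProgramBisimulation programBisimilarity where
  test := fun env t₀ t₁ ⟨X, hX, h⟩ hn E₀ E₁ h₀ h₁ hE =>
    ⟨X, hX, hX.test env t₀ t₁ h hn E₀ E₁ h₀ h₁ hE⟩
  step_left := fun env p₀ p₁ ⟨X, hX, h⟩ h₀ h₁ q hq hs => by
    obtain ⟨r, hr, hs', ht⟩ := hX.step_left env p₀ p₁ h h₀ h₁ q hq hs
    exact ⟨r, hr, hs', X, hX, ht⟩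
  value_left := fun env p₀ p₁ ⟨X, hX, h⟩ h₀ h₁ q hq hs => by
    obtain ⟨r, hr, hs', ht⟩ := hX.value_left env p₀ p₁ h h₀ h₁ q hq hs
    exact ⟨r, hr, hs', X, hX, ht⟩
  step_right := fun env p₀ p₁ ⟨X, hX, h⟩ h₀ h₁ q hq hs => by
    obtain ⟨r, hr, hs', ht⟩ := hX.step_right env p₀ p₁ h h₀ h₁ q hq hs
    exact ⟨r, hr, hs', X, hX, ht⟩
  value_right := fun env p₀ p₁ ⟨X, hX, h⟩ h₀ h₁ q hq hs => by
    obtain ⟨r, hr, hs', ht⟩ := hX.value_right env p₀ p₁ h h₀ h₁ q hq hs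
    exact ⟨r, hr, hs', X, hX, ht⟩
  apply := fun env ⟨X, hX, h⟩ b₀ b₁ hb v₀ v₁ h₀ h₁ hv =>
    ⟨X, hX, hX.apply env h b₀ b₁ hb v₀ v₁ h₀ h₁ hv⟩

/-- The empty environment. -/
def emptyEnv : Tm → Tm → Prop := fun _ _ => False

/-- The open extension of an environmental relation at an environment: `t₀` and `t₁` are related
if their abstractions over all their free variables are (in whatever order the finite set of free
variables is enumerated). -/
def OpenExtension (X : EnvRel) (env : Tm → Tm → Prop) (t₀ t₁ : Tm) : Prop :=
  ∀ xs : List ℕ, xs.Nodup → xs.toFinset = t₀.fv ∪ t₁.fv →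
    X.triples env (Tm.absList xs t₀) (Tm.absList xs t₁)

end LamShift

/-! The terms `t` and `S k. k t` cannot be compared directly. Firing the capture in a context turns
`⟨E[S k. k t]⟩` into `⟨(λ x. ⟨E[x]⟩) t⟩`, and once `t` has become a value `v`, a beta step gives
`⟨⟨E[v]⟩⟩`. The candidate bisimulation is therefore the compatible relation `Expands` generated by
three laws: `t ~ S k. k t`, `⟨E[t]⟩ ~ ⟨(λ x. ⟨E[x]⟩) t⟩` and `⟨t⟩ ~ ⟨⟨t⟩⟩`. The environments are
those contained in `Expands`. Compatibility makes the contextual tests immediate, and stability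
under substitution of values (`Expand.subst`) gives the tests of related abstractions.

From right to left (`Expand.simulate_right`), the left term answers each step with at most one step.
It stays put when the right term performs a step introduced by one of the laws, because the result
is again related by the next law.

From left to right (`simulatedBelow`), the right term may first have to perform several such
administrative steps before it can mirror the left one. Each of them lowers the weight carried by
`Expand`, so strong induction on the weight applies. The main reduction is `CaptureFocus.fire`: a
capture of cost 2 is traded for a delimited application of cost 1. -/

namespace LamShift

/-! ### Locally nameless syntax: lifting, substitution, closing and closedness. -/

namespace Tm

/-- Increment all bound-variable indices that are at least `c`. -/
def lift : ℕ → Tm → Tm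
  | c, bvar i => if i < c then bvar i else bvar (i + 1)
  | _, fvar y => fvar y
  | c, lam b => lam (lift (c + 1) b)
  | c, app t u => app (lift c t) (lift c u)
  | c, shift b => shift (lift (c + 1) b)
  | c, reset t => reset (lift c t)

/-- No free variables, and all dangling indices below `d`. -/
def ClosedAt (d : ℕ) (t : Tm) : Prop := t.LCAt d ∧ t.fv = ∅

@[simp] theorem closedAt_bvar {d i : ℕ} : ClosedAt d (bvar i) ↔ i < d := by
  simp [ClosedAt, LCAt, fv]

@[simp] theorem closedAt_fvar {d x : ℕ} : ¬ ClosedAt d (fvar x) := by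
  simp [ClosedAt, LCAt, fv]

@[simp] theorem closedAt_lam {d : ℕ} {b : Tm} : ClosedAt d (lam b) ↔ ClosedAt (d + 1) b := by
  simp [ClosedAt, LCAt, fv]

@[simp] theorem closedAt_shift {d : ℕ} {b : Tm} :
    ClosedAt d (shift b) ↔ ClosedAt (d + 1) b := by
  simp [ClosedAt, LCAt, fv]

@[simp] theorem closedAt_reset {d : ℕ} {t : Tm} : ClosedAt d (reset t) ↔ ClosedAt d t := by
  simp [ClosedAt, LCAt, fv]

@[simp] theorem closedAt_app {d : ℕ} {t u : Tm} :
    ClosedAt d (app t u) ↔ ClosedAt d t ∧ ClosedAt d u := by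
  simp only [ClosedAt, LCAt, fv, Finset.union_eq_empty]
  tauto

theorem LCAt.mono {d d' : ℕ} {t : Tm} (h : LCAt d t) (hd : d ≤ d') : LCAt d' t := by
  induction t generalizing d d' with
  | bvar i => exact lt_of_lt_of_le h hd
  | fvar x => trivial
  | lam b ih => exact ih (d := d + 1) (d' := d' + 1) h (by omega)
  | app t u iht ihu => exact ⟨iht h.1 hd, ihu h.2 hd⟩
  | shift b ih => exact ih (d := d + 1) (d' := d' + 1) h (by omega)
  | reset t ih => exact ih (d := d) (d' := d') h hd

theorem ClosedAt.mono {d d' : ℕ} {t : Tm} (h : ClosedAt d t) (hd : d ≤ d') : ClosedAt d' t :=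
  ⟨h.1.mono hd, h.2⟩

theorem lift_of_lcAt {c d : ℕ} {t : Tm} (h : LCAt d t) (hd : d ≤ c) : lift c t = t := by
  induction t generalizing c d with
  | bvar i => exact if_pos (lt_of_lt_of_le h hd)
  | fvar x => rfl
  | lam b ih => exact congrArg lam (ih (d := d + 1) h (by omega))
  | app t u iht ihu => exact congrArg₂ app (iht h.1 hd) (ihu h.2 hd)
  | shift b ih => exact congrArg shift (ih (d := d + 1) h (by omega))
  | reset t ih => exact congrArg reset (ih (d := d) h hd)

theorem lcAt_of_lift {c d : ℕ} {t : Tm} (h : LCAt (d + 1) (lift c t)) (hcd : c ≤ d) :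
    LCAt d t := by
  induction t generalizing c d with
  | bvar i =>
    change i < d
    by_cases hc : i < c
    · omega
    · rw [lift, if_neg hc] at h
      exact Nat.lt_of_succ_lt_succ h
  | fvar x => trivial
  | lam b ih => exact ih (d := d + 1) h (by omega)
  | app t u iht ihu => exact ⟨iht h.1 hcd, ihu h.2 hcd⟩
  | shift b ih => exact ih (d := d + 1) h (by omega)
  | reset t ih => exact ih (d := d) h hcd

theorem subst_of_lcAt {d e : ℕ} {u t : Tm} (h : LCAt d t) (hd : d ≤ e) : subst e u t = t := by
  induction t generalizing e d with
  | bvar i =>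
    have : i < d := h
    exact if_neg (by omega)
  | fvar x => rfl
  | lam b ih => exact congrArg lam (ih (d := d + 1) h (by omega))
  | app t u iht ihu => exact congrArg₂ app (iht h.1 hd) (ihu h.2 hd)
  | shift b ih => exact congrArg shift (ih (d := d + 1) h (by omega))
  | reset t ih => exact congrArg reset (ih (d := d) h hd)

theorem subst_lift {c d : ℕ} {u : Tm} (hu : u.LC) (t : Tm) (hcd : c ≤ d) :
    subst (d + 1) u (lift c t) = lift c (subst d u t) := by
  induction t generalizing c d with
  | bvar i =>
    rcases lt_trichotomy i d with h | h | h
    · by_cases hc : i < c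
      · simp [lift, subst, hc, show i ≠ d + 1 by omega, show i ≠ d by omega]
      · simp [lift, subst, hc, show i ≠ d by omega]
    · subst h
      simp [lift, subst, show ¬ i < c by omega, lift_of_lcAt hu (Nat.zero_le c)]
    · simp [lift, subst, show ¬ i < c by omega, show i ≠ d by omega]
  | fvar x => rfl
  | lam b ih => exact congrArg lam (ih (by omega))
  | app t u iht ihu => exact congrArg₂ app (iht hcd) (ihu hcd)
  | shift b ih => exact congrArg shift (ih (by omega))
  | reset t ih => exact congrArg reset (ih hcd)

theorem close_lift {x c d : ℕ} (t : Tm) (hcd : c ≤ d) :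
    close x (d + 1) (lift c t) = lift c (close x d t) := by
  induction t generalizing c d with
  | bvar i => simp only [lift, close]; split <;> rfl
  | fvar y =>
    by_cases h : y = x
    · simp [lift, close, h, show ¬ d < c by omega]
    · simp [lift, close, h]
  | lam b ih => exact congrArg lam (ih (by omega))
  | app t u iht ihu => exact congrArg₂ app (iht hcd) (ihu hcd)
  | shift b ih => exact congrArg shift (ih (by omega))
  | reset t ih => exact congrArg reset (ih hcd)

theorem close_of_notMem_fv {x d : ℕ} {t : Tm} (h : x ∉ t.fv) : close x d t = t := by
  induction t generalizing d with
  | bvar i => rfl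
  | fvar y =>
    have : y ≠ x := fun e => h (by simp [fv, e])
    exact if_neg this
  | lam b ih => exact congrArg lam (ih h)
  | app t u iht ihu =>
    simp only [fv, Finset.mem_union, not_or] at h
    exact congrArg₂ app (iht h.1) (ihu h.2)
  | shift b ih => exact congrArg shift (ih h)
  | reset t ih => exact congrArg reset (ih h)

theorem fv_close (x d : ℕ) (t : Tm) : (close x d t).fv = t.fv.erase x := by
  induction t generalizing d with
  | bvar i => simp [close, fv]
  | fvar y =>
    by_cases h : y = x
    · simp [close, fv, h]
    · ext z
      simp only [close, fv, h, if_false, Finset.mem_singleton, Finset.mem_erase]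
      constructor
      · rintro rfl; exact ⟨h, rfl⟩
      · exact fun hz => hz.2
  | lam b ih => exact ih _
  | app t u iht ihu => simp [close, fv, iht, ihu, Finset.erase_union_distrib]
  | shift b ih => exact ih _
  | reset t ih => exact ih _

theorem LCAt.close {x d : ℕ} {t : Tm} (h : LCAt d t) : LCAt (d + 1) (close x d t) := by
  induction t generalizing d with
  | bvar i => exact Nat.lt_succ_of_lt h
  | fvar y =>
    simp only [Tm.close]
    split
    · exact Nat.lt_succ_self d
    · trivial
  | lam b ih => exact ih (d := d + 1) h
  | app t u iht ihu => exact ⟨iht h.1, ihu h.2⟩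
  | shift b ih => exact ih (d := d + 1) h
  | reset t ih => exact ih (d := d) h

theorem LC.absList {t : Tm} (h : t.LC) (xs : List ℕ) : (absList xs t).LC := by
  induction xs with
  | nil => exact h
  | cons x xs ih => exact LCAt.close (d := 0) ih

theorem fv_absList (xs : List ℕ) (t : Tm) : (absList xs t).fv = t.fv \ xs.toFinset := by
  induction xs with
  | nil => simp [absList]
  | cons x xs ih =>
    have : (absList (x :: xs) t).fv = (absList xs t).fv.erase x := fv_close x 0 _
    rw [this, ih]
    ext z
    simp only [Finset.mem_erase, Finset.mem_sdiff, List.toFinset_cons, Finset.mem_insert]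
    tauto

theorem Closed.absList {t : Tm} (h : t.LC) {xs : List ℕ} (hx : t.fv ⊆ xs.toFinset) :
    (absList xs t).Closed :=
  ⟨h.absList xs, by rw [fv_absList]; exact Finset.sdiff_eq_empty_iff_subset.2 hx⟩

theorem ClosedAt.subst {d : ℕ} {u t : Tm} (ht : ClosedAt (d + 1) t) (hu : u.Closed) :
    ClosedAt d (subst d u t) := by
  induction t generalizing d with
  | bvar i =>
    simp only [closedAt_bvar] at ht
    simp only [Tm.subst]
    split
    · exact ClosedAt.mono (d := 0) hu (Nat.zero_le d)
    · simp only [closedAt_bvar]; omega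
  | fvar x => simp at ht
  | lam b ih => exact closedAt_lam.2 (ih (closedAt_lam.1 ht))
  | app t u iht ihu =>
    have h := closedAt_app.1 ht
    exact closedAt_app.2 ⟨iht h.1, ihu h.2⟩
  | shift b ih => exact closedAt_shift.2 (ih (closedAt_shift.1 ht))
  | reset t ih => exact closedAt_reset.2 (ih (closedAt_reset.1 ht))

/-- The iterated abstractions of `t` and `S k. k t` are iterated abstractions of some `s` and
`S k. k s`. -/
theorem absList_eq_iterate_lam (xs : List ℕ) (t : Tm) :
    ∃ s, absList xs t = lam^[xs.length] s ∧
      absList xs (shift (app (bvar 0) (lift 0 t))) =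
        lam^[xs.length] (shift (app (bvar 0) (lift 0 s))) := by
  have close_iterate : ∀ (x n d : ℕ) (s : Tm),
      close x d (lam^[n] s) = lam^[n] (close x (d + n) s) := by
    intro x n
    induction n with
    | zero => intro d s; rfl
    | succ n ih =>
      intro d s
      rw [Function.iterate_succ_apply', Function.iterate_succ_apply', close, ih,
        show d + 1 + n = d + (n + 1) by omega]
  induction xs with
  | nil => exact ⟨t, rfl, rfl⟩
  | cons x xs ih =>
    obtain ⟨s, h₁, h₂⟩ := ih
    refine ⟨close x xs.length s, ?_, ?_⟩
    · change lam (close x 0 (absList xs t)) = _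
      rw [h₁, close_iterate, Nat.zero_add, List.length_cons, Function.iterate_succ_apply']
    · change lam (close x 0 (absList xs _)) = _
      rw [h₂, close_iterate, Nat.zero_add, List.length_cons, Function.iterate_succ_apply']
      simp only [close]
      rw [close_lift s (Nat.zero_le _)]

end Tm

/-! ### Evaluation contexts: lifting, substitution, composition, closedness. -/

namespace ECtx

/-- Lifting of dangling indices in a context. -/
def lift : ℕ → ECtx → ECtx
  | _, hole => hole
  | c, vapp b F => vapp (b.lift (c + 1)) (F.lift c)
  | c, appt F t => appt (F.lift c) (t.lift c)
  | c, reset F => reset (F.lift c)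

/-- Substitution in a context. -/
def subst (d : ℕ) (u : Tm) : ECtx → ECtx
  | hole => hole
  | vapp b F => vapp (Tm.subst (d + 1) u b) (F.subst d u)
  | appt F t => appt (F.subst d u) (Tm.subst d u t)
  | reset F => reset (F.subst d u)

/-- Composition of contexts: `(F.comp G)[s] = F[G[s]]`. -/
def comp : ECtx → ECtx → ECtx
  | hole, G => G
  | vapp b F, G => vapp b (F.comp G)
  | appt F t, G => appt (F.comp G) t
  | reset F, G => reset (F.comp G)

theorem fill_comp (F G : ECtx) (s : Tm) : (F.comp G).fill s = F.fill (G.fill s) := by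
  induction F with
  | hole => rfl
  | vapp b F ih => simp [comp, fill, ih]
  | appt F t ih => simp [comp, fill, ih]
  | reset F ih => simp [comp, fill, ih]

theorem IsPure.comp {F G : ECtx} (hF : F.IsPure) (hG : G.IsPure) : (F.comp G).IsPure := by
  induction F with
  | hole => exact hG
  | vapp b F ih => exact ih hF
  | appt F t ih => exact ih hF
  | reset F ih => exact hF.elim

theorem IsPure.subst {E : ECtx} (hE : E.IsPure) (d : ℕ) (u : Tm) :
    (E.subst d u).IsPure := by
  induction E with
  | hole => trivial
  | vapp b F ih => exact ih hE
  | appt F t ih => exact ih hE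
  | reset F ih => exact hE.elim

end ECtx

theorem Tm.subst_fill (d : ℕ) (u : Tm) (E : ECtx) (t : Tm) :
    Tm.subst d u (E.fill t) = (E.subst d u).fill (Tm.subst d u t) := by
  induction E with
  | hole => rfl
  | vapp b F ih => simp [ECtx.subst, ECtx.fill, Tm.subst, ih]
  | appt F t ih => simp [ECtx.subst, ECtx.fill, Tm.subst, ih]
  | reset F ih => simp [ECtx.subst, ECtx.fill, Tm.subst, ih]

namespace ECtx

theorem subst_lift {c d : ℕ} {u : Tm} (hu : u.LC) (E : ECtx) (hcd : c ≤ d) :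
    (E.lift c).subst (d + 1) u = (E.subst d u).lift c := by
  induction E with
  | hole => rfl
  | vapp b F ih =>
    simp [lift, subst, ih, Tm.subst_lift hu b (show c + 1 ≤ d + 1 by omega)]
  | appt F t ih => simp [lift, subst, ih, Tm.subst_lift hu t hcd]
  | reset F ih => simp [lift, subst, ih]

theorem lift_of_closed {E : ECtx} {t : Tm} (h : Tm.ClosedAt 0 (E.fill t)) :
    E.lift 0 = E := by
  induction E with
  | hole => rfl
  | vapp b F ih =>
    simp only [fill, Tm.closedAt_app, Tm.closedAt_lam] at h
    simp only [lift, ih h.2]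
    rw [Tm.lift_of_lcAt h.1.1 le_rfl]
  | appt F t ih =>
    simp only [fill, Tm.closedAt_app] at h
    simp only [lift, ih h.1]
    rw [Tm.lift_of_lcAt h.2.1 le_rfl]
  | reset F ih =>
    simp only [fill, Tm.closedAt_reset] at h
    simp only [lift, ih h]

theorem subst_of_closed {d : ℕ} {u : Tm} {E : ECtx} {t : Tm} (h : Tm.ClosedAt 0 (E.fill t)) :
    E.subst d u = E := by
  induction E with
  | hole => rfl
  | vapp b F ih =>
    simp only [fill, Tm.closedAt_app, Tm.closedAt_lam] at h
    simp only [subst, ih h.2]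
    rw [Tm.subst_of_lcAt h.1.1 (by omega)]
  | appt F t ih =>
    simp only [fill, Tm.closedAt_app] at h
    simp only [subst, ih h.1]
    rw [Tm.subst_of_lcAt h.2.1 (Nat.zero_le d)]
  | reset F ih =>
    simp only [fill, Tm.closedAt_reset] at h
    simp only [subst, ih h]

theorem closedAt_of_fill {d : ℕ} {F : ECtx} {s : Tm} (h : Tm.ClosedAt d (F.fill s)) :
    Tm.ClosedAt d s := by
  induction F with
  | hole => exact h
  | vapp b F ih => exact ih (Tm.closedAt_app.1 h).2
  | appt F t ih => exact ih (Tm.closedAt_app.1 h).1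
  | reset F ih => exact ih (Tm.closedAt_reset.1 h)

theorem closedAt_fill {d d' : ℕ} {F : ECtx} {s t : Tm} (h : Tm.ClosedAt d (F.fill s))
    (hd : d ≤ d') (ht : Tm.ClosedAt d' t) : Tm.ClosedAt d' (F.fill t) := by
  induction F with
  | hole => exact ht
  | vapp b F ih =>
    have h := Tm.closedAt_app.1 h
    exact Tm.closedAt_app.2 ⟨h.1.mono hd, ih h.2⟩
  | appt F t ih =>
    have h := Tm.closedAt_app.1 h
    exact Tm.closedAt_app.2 ⟨ih h.1, h.2.mono hd⟩
  | reset F ih => exact Tm.closedAt_reset.2 (ih (Tm.closedAt_reset.1 h))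

theorem fill_ne_lam_of_not_isValue {E : ECtx} {t b : Tm} (ht : ¬ t.IsValue) :
    E.fill t ≠ Tm.lam b := by
  cases E with
  | hole => exact fun h => ht ⟨b, h⟩
  | vapp | appt | reset => simp [fill]

theorem fill_shift_ne_lam {E : ECtx} {b c : Tm} : E.fill (Tm.shift b) ≠ Tm.lam c :=
  fill_ne_lam_of_not_isValue (by rintro ⟨_, h⟩; cases h)

end ECtx

/-! ### Reduction: closedness, compatibility with contexts, inversion. -/

/-- The continuation `λ x. ⟨E[x]⟩` is closed. -/
theorem closed_continuation {E : ECtx} {s : Tm} (h : Tm.ClosedAt 0 (E.fill s)) :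
    (Tm.lam (Tm.reset (E.fill (Tm.bvar 0)))).Closed :=
  Tm.closedAt_lam.2 (Tm.closedAt_reset.2
    (ECtx.closedAt_fill h (Nat.zero_le 1) (Tm.closedAt_bvar.2 Nat.one_pos)))

theorem Step.closed {t s : Tm} (h : Step t s) (ht : t.Closed) : s.Closed := by
  have ht : Tm.ClosedAt 0 t := ht
  cases h with
  | beta F b v hv =>
    have hr := ECtx.closedAt_of_fill ht
    simp only [Tm.closedAt_app, Tm.closedAt_lam] at hr
    exact ECtx.closedAt_fill ht le_rfl (hr.1.subst hr.2)
  | shift F E hE b =>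
    have hr := ECtx.closedAt_of_fill ht
    simp only [Tm.closedAt_reset] at hr
    have hb := ECtx.closedAt_of_fill hr
    simp only [Tm.closedAt_shift] at hb
    exact ECtx.closedAt_fill ht le_rfl
      (Tm.closedAt_reset.2 (hb.subst (closed_continuation hr)))
  | reset F v hv =>
    have hr := ECtx.closedAt_of_fill ht
    exact ECtx.closedAt_fill ht le_rfl (Tm.closedAt_reset.1 hr)

theorem Steps.closed {t s : Tm} (h : Steps t s) (ht : t.Closed) : s.Closed := by
  induction h with
  | refl => exact ht
  | tail _ h ih => exact h.closed ih

theorem Step.fill {t s : Tm} (h : Step t s) (F : ECtx) : Step (F.fill t) (F.fill s) := by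
  cases h with
  | beta G b v hv =>
    rw [← ECtx.fill_comp, ← ECtx.fill_comp]; exact Step.beta _ b v hv
  | shift G E hE b =>
    rw [← ECtx.fill_comp, ← ECtx.fill_comp]; exact Step.shift _ E hE b
  | reset G v hv =>
    rw [← ECtx.fill_comp, ← ECtx.fill_comp]; exact Step.reset _ v hv

theorem Steps.fill {t s : Tm} (h : Steps t s) (F : ECtx) : Steps (F.fill t) (F.fill s) := by
  induction h with
  | refl => exact .refl
  | tail _ h ih => exact ih.tail (h.fill F)

theorem Step.not_lam {b s : Tm} : ¬ Step (Tm.lam b) s := by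
  generalize ht : Tm.lam b = t
  intro h
  cases h with
  | beta F | shift F | reset F => cases F <;> cases ht

theorem Step.not_shift {b s : Tm} : ¬ Step (Tm.shift b) s := by
  generalize ht : Tm.shift b = t
  intro h
  cases h with
  | beta F | shift F | reset F => cases F <;> cases ht

theorem Step.not_bvar {i : ℕ} {s : Tm} : ¬ Step (Tm.bvar i) s := by
  generalize ht : Tm.bvar i = t
  intro h
  cases h with
  | beta F | shift F | reset F => cases F <;> cases ht

theorem Step.not_fvar {x : ℕ} {s : Tm} : ¬ Step (Tm.fvar x) s := by
  generalize ht : Tm.fvar x = t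
  intro h
  cases h with
  | beta F | shift F | reset F => cases F <;> cases ht

theorem Step.app_inv {t u s : Tm} (h : Step (Tm.app t u) s) :
    (∃ t', Step t t' ∧ s = Tm.app t' u) ∨
    (∃ b u', t = Tm.lam b ∧ Step u u' ∧ s = Tm.app t u') ∨
    (∃ b c, t = Tm.lam b ∧ u = Tm.lam c ∧ s = Tm.subst 0 u b) := by
  generalize hr : Tm.app t u = r at h
  cases h with
  | beta F b v hv =>
    cases F with
    | hole =>
      obtain ⟨c, rfl⟩ := hv
      cases hr
      exact .inr (.inr ⟨_, _, rfl, rfl, rfl⟩)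
    | vapp c F => cases hr; exact .inr (.inl ⟨_, _, rfl, Step.beta F b v hv, rfl⟩)
    | appt F c => cases hr; exact .inl ⟨_, Step.beta F b v hv, rfl⟩
    | reset F => cases hr
  | shift F E hE b =>
    cases F with
    | hole => cases hr
    | vapp c F => cases hr; exact .inr (.inl ⟨_, _, rfl, Step.shift F E hE b, rfl⟩)
    | appt F c => cases hr; exact .inl ⟨_, Step.shift F E hE b, rfl⟩
    | reset F => cases hr
  | reset F v hv =>
    cases F with
    | hole => cases hr
    | vapp c F => cases hr; exact .inr (.inl ⟨_, _, rfl, Step.reset F v hv, rfl⟩)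
    | appt F c => cases hr; exact .inl ⟨_, Step.reset F v hv, rfl⟩
    | reset F => cases hr

theorem Step.reset_inv {t s : Tm} (h : Step (Tm.reset t) s) :
    (t.IsValue ∧ s = t) ∨
    (∃ (E : ECtx) (b : Tm), E.IsPure ∧ t = E.fill (Tm.shift b) ∧
      s = Tm.reset (Tm.subst 0 (Tm.lam (Tm.reset (E.fill (Tm.bvar 0)))) b)) ∨
    (∃ t', Step t t' ∧ s = Tm.reset t') := by
  generalize hr : Tm.reset t = r at h
  cases h with
  | beta F b v hv =>
    cases F with
    | reset F => cases hr; exact .inr (.inr ⟨_, Step.beta F b v hv, rfl⟩)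
    | hole | vapp | appt => cases hr
  | shift F E hE b =>
    cases F with
    | hole => cases hr; exact .inr (.inl ⟨E, b, hE, rfl, rfl⟩)
    | reset F => cases hr; exact .inr (.inr ⟨_, Step.shift F E hE b, rfl⟩)
    | vapp | appt => cases hr
  | reset F v hv =>
    cases F with
    | hole => cases hr; exact .inl ⟨hv, rfl⟩
    | reset F => cases hr; exact .inr (.inr ⟨_, Step.reset F v hv, rfl⟩)
    | vapp | appt => cases hr

/-- Steps of programs lead to programs and values. -/
theorem Steps.isProgram_or_isValue {t s : Tm} (h : Steps t s) (ht : t.IsProgram) :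
    s.IsProgram ∨ s.IsValue := by
  induction h with
  | refl => exact .inl ht
  | tail _ h ih =>
    rcases ih with ⟨u, rfl⟩ | ⟨b, rfl⟩
    · rcases h.reset_inv with ⟨hv, rfl⟩ | ⟨_, _, _, _, rfl⟩ | ⟨_, _, rfl⟩
      · exact .inr hv
      · exact .inl ⟨_, rfl⟩
      · exact .inl ⟨_, rfl⟩
    · exact (Step.not_lam h).elim

/-- A capture at the focus of a decomposition is a capture in any subterm at the focus. -/
theorem ECtx.fill_eq_fill_shift {E E' : ECtx} {t b : Tm} (ht : ¬ t.IsValue) (hE : E.IsPure)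
    (hE' : E'.IsPure) (h : E.fill t = E'.fill (Tm.shift b)) :
    ∃ D : ECtx, D.IsPure ∧ t = D.fill (Tm.shift b) ∧ E' = E.comp D := by
  induction E generalizing E' with
  | hole => exact ⟨E', hE', h, rfl⟩
  | vapp c E ih =>
    cases E' with
    | hole => cases h
    | vapp c' E' =>
      simp only [fill, Tm.app.injEq, Tm.lam.injEq] at h
      obtain ⟨D, hD, hD', rfl⟩ := ih (E' := E') hE hE' h.2
      exact ⟨D, hD, hD', by rw [h.1]; rfl⟩
    | appt E' u =>
      simp only [fill, Tm.app.injEq] at h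
      exact (fill_shift_ne_lam h.1.symm).elim
    | reset E' => cases h
  | appt E u ih =>
    cases E' with
    | hole => cases h
    | vapp c' E' =>
      simp only [fill, Tm.app.injEq] at h
      exact (fill_ne_lam_of_not_isValue ht h.1).elim
    | appt E' u' =>
      simp only [fill, Tm.app.injEq] at h
      obtain ⟨D, hD, hD', rfl⟩ := ih (E' := E') hE hE' h.1
      exact ⟨D, hD, hD', by rw [h.2]; rfl⟩
    | reset E' => cases h
  | reset E ih => exact hE.elim

/-- With a non-value in the hole of a pure context, no redex can be formed by the context itself: a
beta redex there would need an abstraction in the hole, and the other two redexes need an enclosing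
reset. -/
theorem Step.fill_inv {E : ECtx} {t s : Tm} (ht : ¬ t.IsValue) (hE : E.IsPure)
    (h : Step (E.fill t) s) : ∃ t', Step t t' ∧ s = E.fill t' := by
  induction E generalizing s with
  | hole => exact ⟨s, h, rfl⟩
  | vapp c E ih =>
    rcases Step.app_inv h with ⟨_, h', _⟩ | ⟨_, u', _, h', rfl⟩ | ⟨_, _, _, h', _⟩
    · exact (Step.not_lam h').elim
    · obtain ⟨t', h'', rfl⟩ := ih hE h'
      exact ⟨t', h'', rfl⟩
    · exact (ECtx.fill_ne_lam_of_not_isValue ht h').elim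
  | appt E u ih =>
    rcases Step.app_inv h with ⟨_, h', rfl⟩ | ⟨_, u', h', _, _⟩ | ⟨_, _, h', _, _⟩
    · obtain ⟨t', h'', rfl⟩ := ih hE h'
      exact ⟨t', h'', rfl⟩
    · exact (ECtx.fill_ne_lam_of_not_isValue ht h').elim
    · exact (ECtx.fill_ne_lam_of_not_isValue ht h').elim
  | reset E ih => exact hE.elim

theorem Step.reset_fill_inv {E : ECtx} {t s : Tm} (ht : ¬ t.IsValue) (hE : E.IsPure)
    (h : Step (Tm.reset (E.fill t)) s) :
    (∃ (D : ECtx) (b : Tm), D.IsPure ∧ t = D.fill (Tm.shift b) ∧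
      s = Tm.reset
        (Tm.subst 0 (Tm.lam (Tm.reset (E.fill (D.fill (Tm.bvar 0))))) b)) ∨
    (∃ t', Step t t' ∧ s = Tm.reset (E.fill t')) := by
  rcases h.reset_inv with ⟨⟨b, h'⟩, rfl⟩ | ⟨E', b, hE', h', rfl⟩ | ⟨u, h', rfl⟩
  · exact (ECtx.fill_ne_lam_of_not_isValue ht h').elim
  · obtain ⟨D, hD, rfl, rfl⟩ := ECtx.fill_eq_fill_shift ht hE hE' h'
    exact .inl ⟨D, b, hD, rfl, by rw [ECtx.fill_comp]⟩
  · obtain ⟨t', h'', rfl⟩ := h'.fill_inv ht hE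
    exact .inr ⟨t', h'', rfl⟩

/-- The shift step, with the pure context split in two and a closed argument of the captured
continuation. -/
theorem Step.capture {G D : ECtx} (hG : G.IsPure) (hD : D.IsPure) {t : Tm} (ht : t.LC) :
    Step (Tm.reset (G.fill (D.fill (Tm.shift (Tm.app (Tm.bvar 0) t)))))
      (Tm.reset (Tm.app (Tm.lam (Tm.reset (G.fill (D.fill (Tm.bvar 0))))) t)) := by
  have h := Step.shift ECtx.hole (G.comp D) (hG.comp hD) (Tm.app (Tm.bvar 0) t)
  simpa only [ECtx.fill, ECtx.fill_comp, Tm.subst, if_true,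
    Tm.subst_of_lcAt (show Tm.LCAt 0 t from ht) le_rfl] using h

end LamShift

/-! ### The candidate relation and its stability under substitution. -/

namespace LamShift

/-- The compatible relation on terms generated by the laws `t ~ S k. k t`,
`⟨E[t]⟩ ~ ⟨(λ x. ⟨E[x]⟩) t⟩` and `⟨t⟩ ~ ⟨⟨t⟩⟩`, oriented from left to right. The index is a weight
that ignores the bodies of abstractions, hence is stable under the substitution of values. -/
inductive Expand : ℕ → Tm → Tm → Prop
  | bvar (i : ℕ) : Expand 0 (Tm.bvar i) (Tm.bvar i)
  | fvar (x : ℕ) : Expand 0 (Tm.fvar x) (Tm.fvar x)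
  | lam {m : ℕ} {b b' : Tm} : Expand m b b' → Expand 0 (Tm.lam b) (Tm.lam b')
  | app {m n : ℕ} {t t' u u' : Tm} : Expand m t t' → Expand n u u' →
      Expand (m + n + 1) (Tm.app t u) (Tm.app t' u')
  | shift {m : ℕ} {b b' : Tm} : Expand m b b' → Expand 0 (Tm.shift b) (Tm.shift b')
  | reset {m : ℕ} {t t' : Tm} : Expand m t t' → Expand (m + 1) (Tm.reset t) (Tm.reset t')
  -- The cost 2 exceeds the cost 1 of `delim`, which is what a fired capture turns into.
  | capture {m : ℕ} {t t' : Tm} : Expand m t t' →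
      Expand (m + 2) t (Tm.shift (Tm.app (Tm.bvar 0) (t'.lift 0)))
  -- The premise relates whole delimited bodies rather than contexts: after a capture inside `⟨(λ x.
  -- ⟨w⟩) □⟩`, the body of the continuation on the right is itself an instance of `delim`, related
  -- to `⟨E[x]⟩` without having its shape. Its weight `m` is counted although it lies under an
  -- abstraction, because the next beta step exposes it.
  | delim {m n : ℕ} {E : ECtx} {w t t' : Tm} : E.IsPure →
      Expand m (Tm.reset ((E.lift 0).fill (Tm.bvar 0))) (Tm.reset w) → Expand n t t' →
      Expand (m + n + 1) (Tm.reset (E.fill t)) (Tm.reset (Tm.app (Tm.lam (Tm.reset w)) t'))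
  | nest {m : ℕ} {t t' : Tm} : Expand m (Tm.reset t) (Tm.reset t') →
      Expand (m + 1) (Tm.reset t) (Tm.reset (Tm.reset t'))

/-- Related by `Expand` with some weight. -/
def Expands (t t' : Tm) : Prop := ∃ n, Expand n t t'

theorem Expands.refl (t : Tm) : Expands t t := by
  induction t with
  | bvar i => exact ⟨_, .bvar i⟩
  | fvar x => exact ⟨_, .fvar x⟩
  | lam b ih => obtain ⟨n, h⟩ := ih; exact ⟨_, .lam h⟩
  | app t u iht ihu => obtain ⟨n, h⟩ := iht; obtain ⟨m, h'⟩ := ihu; exact ⟨_, .app h h'⟩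
  | shift b ih => obtain ⟨n, h⟩ := ih; exact ⟨_, .shift h⟩
  | reset t ih => obtain ⟨n, h⟩ := ih; exact ⟨_, .reset h⟩

/-- Variables and the substituted pair both have weight 0, so the weight is unchanged. Related
abstractions qualify through the `lam` rule, whose weight is 0 whatever the bodies are. -/
theorem Expand.subst {n d : ℕ} {t t' v v' : Tm} (h : Expand n t t') (hv : Expand 0 v v')
    (hc : v.LC) (hc' : v'.LC) : Expand n (Tm.subst d v t) (Tm.subst d v' t') := by
  induction h generalizing d with
  | bvar i =>
    simp only [Tm.subst]
    split
    · exact hv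
    · exact .bvar i
  | fvar x => exact .fvar x
  | lam _ ih => exact .lam ih
  | app _ _ iht ihu => exact .app iht ihu
  | shift _ ih => exact .shift ih
  | reset _ ih => exact .reset ih
  | capture _ ih =>
    have h := Expand.capture (ih (d := d))
    rw [← Tm.subst_lift hc' _ (Nat.zero_le d)] at h
    simpa [Tm.subst] using h
  | @delim m n E w t t' hE _ _ ih₁ ih₂ =>
    have h := ih₁ (d := d + 1)
    simp only [Tm.subst, Tm.subst_fill, ECtx.subst_lift hc E (Nat.zero_le d)] at h
    have h' := Expand.delim (hE.subst d v) h (ih₂ (d := d))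
    simpa only [Tm.subst, Tm.subst_fill] using h'
  | nest _ ih => exact .nest ih

/-- The three laws only put a shift or a reset at the head of the right term, so inversion along the
right term is easy for abstractions and applications. Along the left term, a capture can hide
anything. -/
theorem Expand.lam_inv {n : ℕ} {t b : Tm} (h : Expand n t (Tm.lam b)) :
    ∃ m c, t = Tm.lam c ∧ Expand m c b ∧ n = 0 := by
  cases h with
  | lam h => exact ⟨_, _, rfl, h, rfl⟩

theorem Expand.isProgram {n : ℕ} {t s : Tm} (h : Expand n t (Tm.reset s)) :
    t.IsProgram := by
  generalize hr : Tm.reset s = r at h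
  cases h <;> first | exact ⟨_, rfl⟩ | cases hr

theorem Expand.not_lam {n : ℕ} {t b : Tm} (h : Expand n (Tm.reset t) (Tm.lam b)) : False := by
  obtain ⟨_, _, h, _⟩ := h.lam_inv
  cases h

/-! ### Related contexts and captures at the focus. -/

/-- Contexts that map related terms to related terms, with the weight `e`. -/
def ExpandCtx (e : ℕ) (E E' : ECtx) : Prop :=
  ∀ m s s', Expand m s s' → Expand (m + e) (E.fill s) (E'.fill s')

theorem ExpandCtx.hole : ExpandCtx 0 ECtx.hole ECtx.hole := fun _ _ _ h => h

theorem ExpandCtx.appt {e n : ℕ} {E E' : ECtx} {u u' : Tm} (h : ExpandCtx e E E')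
    (hu : Expand n u u') : ExpandCtx (e + n + 1) (E.appt u) (E'.appt u') := fun m s s' hs => by
  have := (h m s s' hs).app hu
  rwa [show m + e + n + 1 = m + (e + n + 1) by omega] at this

theorem ExpandCtx.vapp {e n : ℕ} {E E' : ECtx} {b b' : Tm} (h : ExpandCtx e E E')
    (hb : Expand n (Tm.lam b) (Tm.lam b')) : ExpandCtx (n + e + 1) (E.vapp b) (E'.vapp b') :=
  fun m s s' hs => by
    have := hb.app (h m s s' hs)
    rwa [show n + (m + e) + 1 = m + (n + e + 1) by omega] at this

theorem ExpandCtx.comp {e g : ℕ} {E E' G G' : ECtx} (hG : ExpandCtx g G G')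
    (hE : ExpandCtx e E E') : ExpandCtx (e + g) (G.comp E) (G'.comp E') := fun m s s' hs => by
  have := hG _ _ _ (hE m s s' hs)
  rw [ECtx.fill_comp, ECtx.fill_comp]
  rwa [show m + e + g = m + (e + g) by omega] at this

/-- A term whose focus is a capture `S k. k t'` that comes from the law `t ~ S k. k t`. -/
def CaptureFocus (n : ℕ) (t t' : Tm) : Prop :=
  ∃ (e m : ℕ) (E E' : ECtx) (s s' : Tm), E.IsPure ∧ E'.IsPure ∧ ExpandCtx e E E' ∧
    Expand m s s' ∧ t = E.fill s ∧
    t' = E'.fill (Tm.shift (Tm.app (Tm.bvar 0) (s'.lift 0))) ∧ n = m + e + 2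

theorem CaptureFocus.of_expand {m : ℕ} {t t' : Tm} (h : Expand m t t') :
    CaptureFocus (m + 2) t (Tm.shift (Tm.app (Tm.bvar 0) (t'.lift 0))) :=
  ⟨0, m, ECtx.hole, ECtx.hole, t, t', trivial, trivial, ExpandCtx.hole, h, rfl, rfl, rfl⟩

theorem CaptureFocus.app_left {m n : ℕ} {t t' u u' : Tm} (h : CaptureFocus m t t')
    (hu : Expand n u u') : CaptureFocus (m + n + 1) (Tm.app t u) (Tm.app t' u') := by
  obtain ⟨e, k, E, E', s, s', hE, hE', hc, hs, rfl, rfl, rfl⟩ := h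
  exact ⟨_, k, E.appt u, E'.appt u', s, s', hE, hE', hc.appt hu, hs, rfl, rfl, by omega⟩

theorem CaptureFocus.app_right {m n : ℕ} {b b' u u' : Tm} (h : CaptureFocus m u u')
    (hb : Expand n (Tm.lam b) (Tm.lam b')) :
    CaptureFocus (n + m + 1) (Tm.app (Tm.lam b) u) (Tm.app (Tm.lam b') u') := by
  obtain ⟨e, k, E, E', s, s', hE, hE', hc, hs, rfl, rfl, rfl⟩ := h
  exact ⟨_, k, E.vapp b, E'.vapp b', s, s', hE, hE', hc.vapp hb, hs, rfl, rfl, by omega⟩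

/-- This dichotomy recurs for each kind of left term: either the right term has the matching shape
and can answer directly, or an administrative capture sits at its evaluation focus and must be fired
first. -/
theorem Expand.lam_focus {n : ℕ} {b t' : Tm} (h : Expand n (Tm.lam b) t') :
    (∃ b' m, t' = Tm.lam b' ∧ Expand m b b' ∧ n = 0) ∨ CaptureFocus n (Tm.lam b) t' := by
  cases h with
  | lam h => exact .inl ⟨_, _, rfl, h, rfl⟩
  | capture h => exact .inr (.of_expand h)

/-- The context is followed in evaluation order. The first place where `capture` was used on this
path is the focus on the right; if there is none, the two contexts match frame by frame. -/
theorem Expand.shift_focus {n : ℕ} {E : ECtx} {b t' : Tm} (hE : E.IsPure)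
    (h : Expand n (E.fill (Tm.shift b)) t') :
    (∃ e m E' b', E'.IsPure ∧ ExpandCtx e E E' ∧ Expand m b b' ∧ n = e ∧
      t' = E'.fill (Tm.shift b')) ∨ CaptureFocus n (E.fill (Tm.shift b)) t' := by
  induction E generalizing n t' with
  | hole =>
    have h : Expand n (Tm.shift b) t' := h
    cases h with
    | shift hb => exact .inl ⟨0, _, ECtx.hole, _, trivial, ExpandCtx.hole, hb, rfl, rfl⟩
    | capture hc => exact .inr (.of_expand hc)
  | vapp c E ih =>
    have h : Expand n (Tm.app (Tm.lam c) (E.fill (Tm.shift b))) t' := h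
    cases h with
    | app ht hu =>
      rcases ht.lam_focus with ⟨c', k, rfl, hc, rfl⟩ | hf
      · rcases ih hE hu with ⟨e, m, E', b', hE', hc', hb, rfl, rfl⟩ | hf
        · exact .inl ⟨_, m, E'.vapp c', b', hE', hc'.vapp ht, hb, rfl, rfl⟩
        · exact .inr (hf.app_right ht)
      · exact .inr (hf.app_left hu)
    | capture hc => exact .inr (.of_expand hc)
  | appt E u ih =>
    have h : Expand n (Tm.app (E.fill (Tm.shift b)) u) t' := h
    cases h with
    | app ht hu =>
      rcases ih hE ht with ⟨e, m, E', b', hE', hc', hb, rfl, rfl⟩ | hf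
      · exact .inl ⟨_, m, E'.appt _, b', hE', hc'.appt hu, hb, rfl, rfl⟩
      · exact .inr (hf.app_left hu)
    | capture hc => exact .inr (.of_expand hc)
  | reset E ih => exact hE.elim

/-! ### Simulation from left to right, by induction on the weight. -/

/-- Steps of programs related with weight less than `N` are simulated from left to right. -/
def SimulatedBelow (N : ℕ) : Prop :=
  ∀ n < N, ∀ t t' s, Expand n (Tm.reset t) (Tm.reset t') → t.Closed → t'.Closed →
    Step (Tm.reset t) s → ∃ s', Steps (Tm.reset t') s' ∧ Expands s s'

/-- Structural induction handles applications, where subterms have smaller weight. It stops at a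
reset: such a subterm is a program of weight below `N`, hence covered by the hypothesis on weights.
-/
theorem Expand.step_focus {N n : ℕ} {t t' s : Tm} (IH : SimulatedBelow N) (hn : n < N)
    (h : Expand n t t') (ht : Tm.ClosedAt 0 t) (ht' : Tm.ClosedAt 0 t') (hs : Step t s) :
    (∃ s', Steps t' s' ∧ Expands s s') ∨ CaptureFocus n t t' := by
  induction t generalizing n t' s with
  | bvar i => exact (Step.not_bvar hs).elim
  | fvar x => exact (Step.not_fvar hs).elim
  | lam b => exact (Step.not_lam hs).elim
  | shift b => exact (Step.not_shift hs).elim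
  | app t u iht ihu =>
    cases h with
    | capture hc => exact .inr (.of_expand hc)
    | app h₁ h₂ =>
      rename_i m₁ m₂ t' u'
      have hm₁ : m₁ < N := by omega
      have hm₂ : m₂ < N := by omega
      rw [Tm.closedAt_app] at ht ht'
      rcases hs.app_inv with ⟨t₁, hr, rfl⟩ | ⟨b, u₁, rfl, hr, rfl⟩ | ⟨b, c, rfl, rfl, rfl⟩
      · rcases iht hm₁ h₁ ht.1 ht'.1 hr with ⟨s', hs', k, hk⟩ | hf
        · exact .inl ⟨_, hs'.fill (ECtx.appt ECtx.hole u'), _, hk.app h₂⟩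
        · exact .inr (hf.app_left h₂)
      · rcases h₁.lam_focus with ⟨b', k, rfl, -, -⟩ | hf
        · rcases ihu hm₂ h₂ ht.2 ht'.2 hr with ⟨s', hs', k, hk⟩ | hf
          · exact .inl ⟨_, hs'.fill (ECtx.vapp b' ECtx.hole), _, h₁.app hk⟩
          · exact .inr (hf.app_right h₁)
        · exact .inr (hf.app_left h₂)
      · rcases h₁.lam_focus with ⟨b', k, rfl, hb, -⟩ | hf
        · rcases h₂.lam_focus with ⟨c', k', rfl, hc, rfl⟩ | hf
          · exact .inl ⟨_, .single (Step.beta ECtx.hole b' _ ⟨c', rfl⟩), _,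
              hb.subst h₂ ht.2.1 ht'.2.1⟩
          · exact .inr (hf.app_right h₁)
        · exact .inr (hf.app_left h₂)
  | reset t ih =>
    have key : ∀ r, t' = Tm.reset r → ∃ s', Steps t' s' ∧ Expands s s' := by
      rintro r rfl
      rw [Tm.closedAt_reset] at ht ht'
      exact IH n hn t r s h ht ht' hs
    generalize hr : Tm.reset t = r at h
    cases h with
    | capture hc => exact .inr (.of_expand hc)
    | reset | delim | nest => exact .inl (key _ rfl)
    | bvar | fvar | lam | app | shift => cases hr

theorem Expand.delim_of_closed {m n : ℕ} {E : ECtx} {w t t' : Tm} (hE : E.IsPure)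
    (hc : Tm.ClosedAt 0 (E.fill t))
    (h : Expand m (Tm.reset (E.fill (Tm.bvar 0))) (Tm.reset w)) (ht : Expand n t t') :
    Expand (m + n + 1) (Tm.reset (E.fill t)) (Tm.reset (Tm.app (Tm.lam (Tm.reset w)) t')) :=
  .delim hE (by rwa [ECtx.lift_of_closed hc]) ht

/-- Contexts that yield related programs from related terms. -/
def ExpandResetCtx (g : ℕ) (G G' : ECtx) : Prop :=
  ∀ m s s', Expand m s s' → Expand (m + g + 1) (Tm.reset (G.fill s)) (Tm.reset (G'.fill s'))

theorem ExpandCtx.reset {g : ℕ} {G G' : ECtx} (h : ExpandCtx g G G') : ExpandResetCtx g G G' :=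
  fun m s s' hs => (h m s s' hs).reset

theorem ExpandResetCtx.comp {e g : ℕ} {E E' G G' : ECtx} (hG : ExpandResetCtx g G G')
    (hE : ExpandCtx e E E') : ExpandResetCtx (e + g) (G.comp E) (G'.comp E') := fun m s s' hs => by
  have := hG _ _ _ (hE m s s' hs)
  rw [ECtx.fill_comp, ECtx.fill_comp]
  rwa [show m + e + g = m + (e + g) by omega] at this

/-- This lets `delim` be treated like an ordinary reset: the pair formed by `E` and `(λ x. ⟨w⟩) □`
behaves as a pair of related contexts once both are delimited. -/
theorem ExpandResetCtx.of_delim {m : ℕ} {E : ECtx} {w t : Tm} (hE : E.IsPure)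
    (hc : Tm.ClosedAt 0 (E.fill t))
    (h : Expand m (Tm.reset (E.fill (Tm.bvar 0))) (Tm.reset w)) :
    ExpandResetCtx m E (ECtx.vapp (Tm.reset w) ECtx.hole) := fun n s s' hs => by
  have h' := Expand.delim (t := s) (t' := s') hE (by rwa [ECtx.lift_of_closed hc]) hs
  rwa [show m + n + 1 = n + m + 1 by omega] at h'

/-- Firing the capture of `S k. k t'` gives a program related with less weight. -/
theorem CaptureFocus.fire {g n : ℕ} {G G' : ECtx} {t t' : Tm} (hG : G.IsPure) (hG' : G'.IsPure)
    (H : ExpandResetCtx g G G') (h : CaptureFocus n t t') (hc : Tm.ClosedAt 0 (G.fill t))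
    (hc' : Tm.ClosedAt 0 (G'.fill t')) :
    ∃ m < n + g + 1, ∃ u, Step (Tm.reset (G'.fill t')) (Tm.reset u) ∧
      Expand m (Tm.reset (G.fill t)) (Tm.reset u) := by
  obtain ⟨e, m, E, E', s, s', hE, hE', hEE, hs, rfl, rfl, rfl⟩ := h
  have hl : s'.LC := by
    have := ECtx.closedAt_of_fill (ECtx.closedAt_of_fill hc')
    exact Tm.lcAt_of_lift (Tm.closedAt_app.1 (Tm.closedAt_shift.1 this)).2.1 le_rfl
  rw [Tm.lift_of_lcAt hl le_rfl]
  rw [← ECtx.fill_comp] at hc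
  have h := (H.comp hEE) _ _ _ (.bvar 0)
  rw [ECtx.fill_comp G'] at h
  -- The weight here is `m + e + g + 2`, against `m + e + g + 3` before firing.
  have h' := Expand.delim_of_closed (hG.comp hE) hc h hs
  rw [ECtx.fill_comp] at h'
  exact ⟨_, by omega, _, Step.capture hG' hE' hl, h'⟩

/-- The right program fires its capture while the left one waits; the pair then has smaller weight,
and the induction hypothesis answers the original left step. -/
theorem CaptureFocus.simulate {N g n : ℕ} {G G' : ECtx} {t t' s : Tm} (IH : SimulatedBelow N)
    (hN : n + g + 1 ≤ N) (hG : G.IsPure) (hG' : G'.IsPure) (H : ExpandResetCtx g G G')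
    (h : CaptureFocus n t t') (hc : Tm.ClosedAt 0 (G.fill t))
    (hc' : Tm.ClosedAt 0 (G'.fill t')) (hs : Step (Tm.reset (G.fill t)) s) :
    ∃ s', Steps (Tm.reset (G'.fill t')) s' ∧ Expands s s' := by
  obtain ⟨m, hm, u, hu, hmu⟩ := h.fire hG hG' H hc hc'
  have hcu : Tm.ClosedAt 0 u := Tm.closedAt_reset.1 (hu.closed (Tm.closedAt_reset.2 hc'))
  obtain ⟨s', hs', hss⟩ := IH m (by omega) _ _ s hmu hc hcu hs
  exact ⟨s', .head hu hs', hss⟩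

/-- Contracting related captures in related contexts. -/
theorem Expand.subst_continuation {g m : ℕ} {G G' : ECtx} {b b' : Tm}
    (H : ExpandResetCtx g G G') (hb : Expand m b b')
    (hc : Tm.ClosedAt 0 (G.fill (Tm.shift b))) (hc' : Tm.ClosedAt 0 (G'.fill (Tm.shift b'))) :
    Expands (Tm.reset (Tm.subst 0 (Tm.lam (Tm.reset (G.fill (Tm.bvar 0)))) b))
      (Tm.reset (Tm.subst 0 (Tm.lam (Tm.reset (G'.fill (Tm.bvar 0)))) b')) :=
  ⟨_, .reset (hb.subst (.lam (H _ _ _ (.bvar 0))) (closed_continuation hc).1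
    (closed_continuation hc').1)⟩

/-- A non-value in the hole leaves two kinds of step: a capture up to the enclosing reset, or a step
inside the hole. In both, the right term either mirrors the step or has an administrative capture to
fire. -/
theorem ExpandResetCtx.simulate {N g n : ℕ} {G G' : ECtx} {t t' s : Tm} (IH : SimulatedBelow N)
    (hN : n + g + 1 ≤ N) (hG : G.IsPure) (hG' : G'.IsPure) (H : ExpandResetCtx g G G')
    (h : Expand n t t') (hv : ¬ t.IsValue) (hc : Tm.ClosedAt 0 (G.fill t))
    (hc' : Tm.ClosedAt 0 (G'.fill t')) (hs : Step (Tm.reset (G.fill t)) s) :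
    ∃ s', Steps (Tm.reset (G'.fill t')) s' ∧ Expands s s' := by
  rcases Step.reset_fill_inv hv hG hs with ⟨D, b, hD, rfl, rfl⟩ | ⟨r, hr, rfl⟩
  · rcases h.shift_focus hD with ⟨e, m, D', b', hD', hDD, hb, rfl, rfl⟩ | hf
    · have hst := Step.shift ECtx.hole (G'.comp D') (hG'.comp hD') b'
      have hE := Expand.subst_continuation (H.comp hDD) hb (by rwa [ECtx.fill_comp])
        (by rwa [ECtx.fill_comp])
      simp only [ECtx.fill, ECtx.fill_comp] at hst hE
      exact ⟨_, .single hst, hE⟩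
    · exact hf.simulate IH hN hG hG' H hc hc' hs
  · rcases h.step_focus IH (by omega) (ECtx.closedAt_of_fill hc) (ECtx.closedAt_of_fill hc') hr
      with ⟨r', hr', k, hk⟩ | hf
    · exact ⟨_, (hr'.fill G').fill (ECtx.reset ECtx.hole), _, H _ _ _ hk⟩
    · exact hf.simulate IH hN hG hG' H hc hc' hs

/-- An additional reset on the right preserves the simulation of steps to programs and values. -/
theorem Expands.nest {t r q q' : Tm} (hq : Step (Tm.reset t) q)
    (hs : Steps (Tm.reset r) q') (h : Expands q q') :
    ∃ s', Steps (Tm.reset (Tm.reset r)) s' ∧ Expands q s' := by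
  obtain ⟨n, h⟩ := h
  have hs₂ : Steps (Tm.reset (Tm.reset r)) (Tm.reset q') := hs.fill (ECtx.reset ECtx.hole)
  rcases Steps.isProgram_or_isValue hs ⟨r, rfl⟩ with ⟨u', rfl⟩ | hv
  · obtain ⟨u, rfl⟩ := h.isProgram
    exact ⟨_, hs₂, _, .nest h⟩
  · exact ⟨_, hs₂.tail (Step.reset ECtx.hole q' hv), _, h⟩

theorem simulatedBelow (N : ℕ) : SimulatedBelow N := by
  induction N with
  | zero => exact fun n hn => (Nat.not_lt_zero n hn).elim
  | succ N IH =>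
    intro n hn t t' s h ht ht' hs
    rcases Nat.lt_succ_iff_lt_or_eq.1 hn with hn | rfl
    · exact IH n hn t t' s h ht ht' hs
    have ht : Tm.ClosedAt 0 t := ht
    have ht' : Tm.ClosedAt 0 t' := ht'
    cases h with
    | reset h =>
      have H := ExpandCtx.hole.reset
      by_cases hv : t.IsValue
      · obtain ⟨b, rfl⟩ := hv
        rcases h.lam_focus with ⟨b', m, rfl, hb, rfl⟩ | hf
        · rcases hs.reset_inv with ⟨-, rfl⟩ | ⟨E, _, _, h', _⟩ | ⟨_, h', _⟩
          · exact ⟨_, .single (Step.reset ECtx.hole _ ⟨b', rfl⟩), _, h⟩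
          · exact (ECtx.fill_shift_ne_lam h'.symm).elim
          · exact (Step.not_lam h').elim
        · exact hf.simulate IH le_rfl (G := ECtx.hole) (G' := ECtx.hole) trivial trivial H ht ht' hs
      · exact H.simulate IH le_rfl (G := ECtx.hole) (G' := ECtx.hole) trivial trivial h hv ht ht' hs
    | @delim m n E w t t' hE hw h =>
      rw [ECtx.lift_of_closed ht] at hw
      have H := ExpandResetCtx.of_delim hE ht hw
      have hN : n + m + 1 ≤ m + n + 1 := by omega
      by_cases hv : t.IsValue
      · obtain ⟨b, rfl⟩ := hv
        rcases h.lam_focus with ⟨b', k, rfl, hb, rfl⟩ | hf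
        · have hc := Tm.closedAt_app.1 ht'
          have hcb := ECtx.closedAt_of_fill ht
          -- Both arguments are abstractions, so the right program beta-reduces to a doubly
          -- delimited program whose inner part is related to `⟨E[v]⟩` with weight `m` only. The
          -- induction hypothesis applies there, and `Expands.nest` restores the outer reset.
          have hwb := hw.subst (d := 0) h hcb.1 hc.2.1
          simp only [Tm.subst, Tm.subst_fill, ECtx.subst_of_closed ht, if_true] at hwb
          obtain ⟨s', hs', hss⟩ := IH m (by omega) _ _ s hwb ht
            ((Tm.closedAt_reset.1 (Tm.closedAt_lam.1 hc.1)).subst hc.2) hs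
          obtain ⟨r, hr, hsr⟩ := Expands.nest hs hs' hss
          exact ⟨r, .head (Step.beta (ECtx.reset ECtx.hole) _ _ ⟨b', rfl⟩) hr, hsr⟩
        · exact hf.simulate IH hN hE (G' := .vapp _ .hole) trivial H ht ht' hs
      · exact H.simulate IH hN hE (G' := .vapp _ .hole) trivial h hv ht ht' hs
    | nest h =>
      obtain ⟨q, hq, hsq⟩ := IH _ (Nat.lt_succ_self _) _ _ s h ht (Tm.closedAt_reset.1 ht') hs
      exact Expands.nest hs hq hsq

theorem Expand.simulate_left {n : ℕ} {t t' s : Tm} (h : Expand n (Tm.reset t) (Tm.reset t'))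
    (ht : (Tm.reset t).Closed) (ht' : (Tm.reset t').Closed) (hs : Step (Tm.reset t) s) :
    ∃ s', Steps (Tm.reset t') s' ∧ Expands s s' :=
  simulatedBelow (n + 1) n (Nat.lt_succ_self n) t t' s h ht ht' hs

/-! ### Simulation from right to left, by induction on the derivation. -/

theorem Expand.fill_shift_inv {n : ℕ} {E' : ECtx} {t b' : Tm} (hE' : E'.IsPure)
    (h : Expand n t (E'.fill (Tm.shift b'))) :
    ∃ e m E s, E.IsPure ∧ ExpandCtx e E E' ∧ Expand m s (Tm.shift b') ∧ t = E.fill s := by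
  induction E' generalizing n t with
  | hole => exact ⟨0, n, ECtx.hole, t, trivial, ExpandCtx.hole, h, rfl⟩
  | vapp c' E' ih =>
    have h : Expand n t (Tm.app (Tm.lam c') (E'.fill (Tm.shift b'))) := h
    cases h with
    | app h₁ h₂ =>
      obtain ⟨e, m, E, s, hE, hEE, hs, rfl⟩ := ih hE' h₂
      obtain ⟨_, c, rfl, _, rfl⟩ := h₁.lam_inv
      exact ⟨_, m, E.vapp c, s, hE, hEE.vapp h₁, hs, rfl⟩
  | appt E' u' ih =>
    have h : Expand n t (Tm.app (E'.fill (Tm.shift b')) u') := h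
    cases h with
    | app h₁ h₂ =>
      obtain ⟨e, m, E, s, hE, hEE, hs, rfl⟩ := ih hE' h₁
      exact ⟨_, m, E.appt _, s, hE, hEE.appt h₂, hs, rfl⟩
  | reset E' ih => exact hE'.elim

theorem ExpandResetCtx.simulate_right {g n : ℕ} {G G' : ECtx} {t t' s' : Tm}
    (hG : G.IsPure) (hG' : G'.IsPure) (H : ExpandResetCtx g G G') (h : Expand n t t')
    (hv : ¬ t'.IsValue) (hc : Tm.ClosedAt 0 (G.fill t)) (hc' : Tm.ClosedAt 0 (G'.fill t'))
    (ih : ∀ r', Step t' r' → ∃ r, Steps t r ∧ Expands r r')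
    (hs : Step (Tm.reset (G'.fill t')) s') :
    ∃ s, Steps (Tm.reset (G.fill t)) s ∧ Expands s s' := by
  rcases Step.reset_fill_inv hv hG' hs with ⟨D', b', hD', rfl, rfl⟩ | ⟨r', hr, rfl⟩
  · obtain ⟨e, m, D, u, hD, hDD, hu, rfl⟩ := h.fill_shift_inv hD'
    have HD := H.comp hDD
    rw [← ECtx.fill_comp] at hc hc'
    cases hu with
    | @shift _ b _ hb =>
      have hst := Step.shift ECtx.hole (G.comp D) (hG.comp hD) b
      have hE := Expand.subst_continuation HD hb hc hc'
      simp only [ECtx.fill, ECtx.fill_comp] at hst hE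
      exact ⟨_, .single hst, hE⟩
    | capture hu =>
      rename_i m u'
      have hl : u'.LC := Tm.lcAt_of_lift
        (Tm.closedAt_app.1 (Tm.closedAt_shift.1 (ECtx.closedAt_of_fill hc'))).2.1 le_rfl
      have h' := Expand.delim_of_closed (hG.comp hD) hc (HD _ _ _ (.bvar 0)) hu
      rw [ECtx.fill_comp, ECtx.fill_comp] at h'
      -- The right capture is administrative: the left program does not move, and its result is
      -- related by `delim`, with the continuation body compared through the variable in the hole.
      refine ⟨_, .refl, 0 + (e + g) + 1 + m + 1, ?_⟩
      simpa only [Tm.subst, if_true, Tm.lift_of_lcAt hl le_rfl,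
        Tm.subst_of_lcAt (show Tm.LCAt 0 u' from hl) le_rfl] using h'
  · obtain ⟨r, hr', k, hk⟩ := ih r' hr
    exact ⟨_, (hr'.fill G).fill (ECtx.reset ECtx.hole), _, H _ _ _ hk⟩

theorem Expand.simulate_right {n : ℕ} {t t' s' : Tm} (h : Expand n t t')
    (ht : Tm.ClosedAt 0 t) (ht' : Tm.ClosedAt 0 t') (hs : Step t' s') :
    ∃ s, Steps t s ∧ Expands s s' := by
  induction h generalizing s' with
  | bvar => exact (Step.not_bvar hs).elim
  | fvar => exact (Step.not_fvar hs).elim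
  | lam => exact (Step.not_lam hs).elim
  | shift => exact (Step.not_shift hs).elim
  | capture => exact (Step.not_shift hs).elim
  | @app m n t t' u u' h₁ h₂ ih₁ ih₂ =>
    rw [Tm.closedAt_app] at ht ht'
    rcases hs.app_inv with ⟨t₁, hr, rfl⟩ | ⟨b', u₁, rfl, hr, rfl⟩ | ⟨b', c', rfl, rfl, rfl⟩
    · obtain ⟨r, hr', k, hk⟩ := ih₁ ht.1 ht'.1 hr
      exact ⟨_, hr'.fill (ECtx.appt ECtx.hole u), _, hk.app h₂⟩
    · obtain ⟨_, b, rfl, _, rfl⟩ := h₁.lam_inv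
      obtain ⟨r, hr', k, hk⟩ := ih₂ ht.2 ht'.2 hr
      exact ⟨_, hr'.fill (ECtx.vapp b ECtx.hole), _, h₁.app hk⟩
    · obtain ⟨_, b, rfl, hb, rfl⟩ := h₁.lam_inv
      obtain ⟨_, c, rfl, _, rfl⟩ := h₂.lam_inv
      exact ⟨_, .single (Step.beta ECtx.hole b _ ⟨c, rfl⟩), _, hb.subst h₂ ht.2.1 ht'.2.1⟩
  | @reset m t t' h ih =>
    rw [Tm.closedAt_reset] at ht ht'
    by_cases hv : t'.IsValue
    · obtain ⟨b', rfl⟩ := hv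
      obtain ⟨_, b, rfl, hb, rfl⟩ := h.lam_inv
      rcases hs.reset_inv with ⟨-, rfl⟩ | ⟨E, _, _, h', _⟩ | ⟨_, h', _⟩
      · exact ⟨_, .single (Step.reset ECtx.hole _ ⟨b, rfl⟩), _, h⟩
      · exact (ECtx.fill_shift_ne_lam h'.symm).elim
      · exact (Step.not_lam h').elim
    · exact ExpandCtx.hole.reset.simulate_right (G := ECtx.hole) (G' := ECtx.hole)
        trivial trivial h hv ht ht' (fun r' hr => ih ht ht' hr) hs
  | @delim m n E w t t' hE hw h _ ih =>
    rw [Tm.closedAt_reset] at ht ht'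
    have hc := Tm.closedAt_app.1 ht'
    have hct := ECtx.closedAt_of_fill ht
    rw [ECtx.lift_of_closed ht] at hw
    by_cases hv : t'.IsValue
    · obtain ⟨b', rfl⟩ := hv
      obtain ⟨_, b, rfl, hb, rfl⟩ := h.lam_inv
      rcases hs.reset_inv with ⟨⟨_, h'⟩, _⟩ | ⟨D, _, _, h', _⟩ | ⟨_, h', rfl⟩
      · cases h'
      · cases D with
        | hole | reset => cases h'
        | vapp => exact (ECtx.fill_shift_ne_lam (Tm.app.inj h').2.symm).elim
        | appt => exact (ECtx.fill_shift_ne_lam (Tm.app.inj h').1.symm).elim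
      · rcases h'.app_inv with ⟨_, h', _⟩ | ⟨_, _, _, h', _⟩ | ⟨_, _, hl, -, rfl⟩
        · exact (Step.not_lam h').elim
        · exact (Step.not_lam h').elim
        · cases hl
          have hwb := hw.subst (d := 0) h hct.1 hc.2.1
          simp only [Tm.subst, Tm.subst_fill, ECtx.subst_of_closed ht, if_true] at hwb
          -- The right beta step is administrative: the left program `⟨E[v]⟩` waits, and `delim`
          -- gives way to `nest`.
          exact ⟨_, .refl, _, .nest hwb⟩
    · exact (ExpandResetCtx.of_delim hE ht hw).simulate_right hE (G' := .vapp _ .hole) trivial h hv ht ht'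
        (fun r' hr => ih hct hc.2 hr) hs
  | @nest m t t' h ih =>
    rw [Tm.closedAt_reset] at ht'
    rcases hs.reset_inv with ⟨⟨_, h'⟩, _⟩ | ⟨D, _, hD, h', _⟩ | ⟨r', hr, rfl⟩
    · cases h'
    · cases D with
      | hole | vapp | appt => cases h'
      | reset => exact hD.elim
    · rcases Steps.isProgram_or_isValue (.single hr) ⟨t', rfl⟩ with ⟨u', rfl⟩ | hv
      · obtain ⟨r, hr', k, hk⟩ := ih ht ht' hr
        obtain ⟨u, rfl⟩ := hk.isProgram
        exact ⟨_, hr', _, .nest hk⟩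
      · rcases hr.reset_inv with ⟨-, rfl⟩ | ⟨_, _, _, _, rfl⟩ | ⟨_, _, rfl⟩
        -- The inner reset disappears around a value, which undoes `nest`; the left program waits.
        · exact ⟨_, .refl, _, h⟩
        all_goals obtain ⟨_, hv⟩ := hv; cases hv

/-! ### The bisimulation and the conclusion for open terms. -/

theorem TermClosure.expands {R : Tm → Tm → Prop} (hR : ∀ t t', R t t' → Expands t t')
    {t t' : Tm} (h : TermClosure R t t') : Expands t t' := by
  induction h with
  | base h => exact hR _ _ h
  | bvar i => exact ⟨_, .bvar i⟩
  | fvar x => exact ⟨_, .fvar x⟩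
  | lam _ ih => obtain ⟨n, h⟩ := ih; exact ⟨_, .lam h⟩
  | app _ _ iht ihu => obtain ⟨n, h⟩ := iht; obtain ⟨m, h'⟩ := ihu; exact ⟨_, .app h h'⟩
  | shift _ ih => obtain ⟨n, h⟩ := ih; exact ⟨_, .shift h⟩
  | reset _ ih => obtain ⟨n, h⟩ := ih; exact ⟨_, .reset h⟩

theorem CtxClosure.expands {R : Tm → Tm → Prop} (hR : ∀ t t', R t t' → Expands t t')
    {F F' : ECtx} (h : CtxClosure R F F') {t t' : Tm} (ht : Expands t t') :
    Expands (F.fill t) (F'.fill t') := by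
  induction h with
  | hole => exact ht
  | vapp _ hb ih =>
    obtain ⟨n, h⟩ := ih; obtain ⟨m, h'⟩ := hb.1.expands hR; exact ⟨_, .app h' h⟩
  | appt _ hb ih =>
    obtain ⟨n, h⟩ := ih; obtain ⟨m, h'⟩ := hb.1.expands hR; exact ⟨_, .app h h'⟩
  | reset _ ih => obtain ⟨n, h⟩ := ih; exact ⟨_, .reset h⟩

theorem CtxClosure.closed {R : Tm → Tm → Prop} {F F' : ECtx} (h : CtxClosure R F F')
    {t t' : Tm} (ht : Tm.ClosedAt 0 t) (ht' : Tm.ClosedAt 0 t') :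
    Tm.ClosedAt 0 (F.fill t) ∧ Tm.ClosedAt 0 (F'.fill t') := by
  induction h with
  | hole => exact ⟨ht, ht'⟩
  | vapp _ hb ih =>
    exact ⟨Tm.closedAt_app.2 ⟨hb.2.1, ih.1⟩, Tm.closedAt_app.2 ⟨hb.2.2, ih.2⟩⟩
  | appt _ hb ih =>
    exact ⟨Tm.closedAt_app.2 ⟨ih.1, hb.2.1⟩, Tm.closedAt_app.2 ⟨ih.2, hb.2.2⟩⟩
  | reset _ ih => exact ⟨Tm.closedAt_reset.2 ih.1, Tm.closedAt_reset.2 ih.2⟩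

/-- Closed terms related by `Expands`, in environments contained in `Expands`. -/
def expandRel : EnvRel where
  envs env := IsEnv env ∧ ∀ v v', env v v' → Expands v v'
  triples env t₀ t₁ := (IsEnv env ∧ ∀ v v', env v v' → Expands v v') ∧
    (t₀.Closed ∧ t₁.Closed) ∧ Expands t₀ t₁
  envs_isEnv := fun _ h => h.1
  triples_wf := fun _ _ _ h => ⟨h.1.1, h.2.1⟩

theorem expandRel_extend {env : Tm → Tm → Prop} (henv : expandRel.envs env) {v v' : Tm}
    (hv : v.IsValue) (hv' : v'.IsValue) (hc : v.Closed) (hc' : v'.Closed) (h : Expands v v') :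
    expandRel.envs (extend env v v') := by
  constructor
  · rintro w w' (⟨rfl, rfl⟩ | hw)
    · exact ⟨⟨hv, hc⟩, hv', hc'⟩
    · exact henv.1 w w' hw
  · rintro w w' (⟨rfl, rfl⟩ | hw)
    · exact h
    · exact henv.2 w w' hw

theorem expandRel_isProgramBisimulation : IsProgramBisimulation expandRel where
  test := fun env t₀ t₁ ⟨henv, hc, h⟩ _ E₀ E₁ _ _ hE => by
    obtain ⟨n, h⟩ := hE.expands henv.2 h
    exact ⟨henv, hE.reset.closed hc.1 hc.2, _, .reset h⟩
  step_left := by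
    rintro env _ _ ⟨henv, hc, n, h⟩ ⟨t, rfl⟩ ⟨t', rfl⟩ _ ⟨s, rfl⟩ hs
    obtain ⟨q, hq, k, hk⟩ := h.simulate_left hc.1 hc.2 hs
    rcases hq.isProgram_or_isValue ⟨t', rfl⟩ with hp | ⟨b, rfl⟩
    · exact ⟨q, hp, hq, henv, ⟨hs.closed hc.1, hq.closed hc.2⟩, k, hk⟩
    · exact hk.not_lam.elim
  value_left := by
    rintro env _ _ ⟨henv, hc, n, h⟩ ⟨t, rfl⟩ ⟨t', rfl⟩ _ ⟨b, rfl⟩ hs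
    obtain ⟨q, hq, k, hk⟩ := h.simulate_left hc.1 hc.2 hs
    rcases hq.isProgram_or_isValue ⟨t', rfl⟩ with ⟨u, rfl⟩ | hv
    · obtain ⟨_, hu⟩ := hk.isProgram
      cases hu
    · exact ⟨q, hv, hq, expandRel_extend henv ⟨b, rfl⟩ hv (hs.closed hc.1) (hq.closed hc.2)
        ⟨k, hk⟩⟩
  step_right := by
    rintro env _ _ ⟨henv, hc, n, h⟩ ⟨t, rfl⟩ ⟨t', rfl⟩ _ ⟨s, rfl⟩ hs
    obtain ⟨q, hq, k, hk⟩ := h.simulate_right hc.1 hc.2 hs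
    exact ⟨q, hk.isProgram, hq, henv, ⟨hq.closed hc.1, hs.closed hc.2⟩, k, hk⟩
  value_right := by
    rintro env _ _ ⟨henv, hc, n, h⟩ ⟨t, rfl⟩ ⟨t', rfl⟩ _ ⟨b, rfl⟩ hs
    obtain ⟨q, hq, k, hk⟩ := h.simulate_right hc.1 hc.2 hs
    obtain ⟨_, c, rfl, _⟩ := hk.lam_inv
    exact ⟨_, ⟨c, rfl⟩, hq, expandRel_extend henv ⟨c, rfl⟩ ⟨b, rfl⟩ (hq.closed hc.1)
      (hs.closed hc.2) ⟨k, hk⟩⟩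
  apply := by
    rintro env henv b₀ b₁ hb v₀ v₁ - ⟨c, rfl⟩ hv
    have hcb := henv.1 _ _ hb
    obtain ⟨_, h⟩ := henv.2 _ _ hb
    obtain ⟨k, hk⟩ := hv.1.expands henv.2
    -- The right argument is an abstraction, which forces the weight to be 0 as `Expand.subst`
    -- requires.
    obtain ⟨_, c₀, rfl, _, rfl⟩ := hk.lam_inv
    obtain ⟨_, _, hl, h, -⟩ := h.lam_inv
    cases hl
    exact ⟨henv, ⟨(Tm.closedAt_lam.1 hcb.1.2).subst hv.2.1,
      (Tm.closedAt_lam.1 hcb.2.2).subst hv.2.2⟩, _, h.subst hk hv.2.1.1 hv.2.2.1⟩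

theorem Tm.capture_app_fvar {k : ℕ} {t : Tm} (ht : t.LC) (hk : k ∉ t.fv) :
    capture k (app (fvar k) t) = shift (app (bvar 0) (lift 0 t)) := by
  simp [capture, close, close_of_notMem_fv hk, lift_of_lcAt ht le_rfl]

/-- Closing commutes with the law `t ~ S k. k t`, so the abstracted pair is an instance of that law
for a term `s` with dangling indices, placed under abstractions. Reflexivity at `s` and the rules
`capture` and `lam` then suffice. -/
theorem expands_absList (xs : List ℕ) (t : Tm) :
    Expands (Tm.absList xs t)
      (Tm.absList xs (Tm.shift (Tm.app (Tm.bvar 0) (t.lift 0)))) := by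
  obtain ⟨s, h₁, h₂⟩ := Tm.absList_eq_iterate_lam xs t
  rw [h₁, h₂]
  induction xs.length with
  | zero =>
    obtain ⟨n, h⟩ := Expands.refl s
    exact ⟨_, .capture h⟩
  | succ n ih =>
    obtain ⟨m, h⟩ := ih
    rw [Function.iterate_succ_apply', Function.iterate_succ_apply']
    exact ⟨_, .lam h⟩

end LamShift

theorem lemmal (t : LamShift.Tm) (ht : t.LC) (k : ℕ) (hk : k ∉ t.fv) :
    LamShift.OpenExtension LamShift.programBisimilarity LamShift.emptyEnv
      t (LamShift.Tm.capture k (LamShift.Tm.app (LamShift.Tm.fvar k) t)) := by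
  intro xs _ hxs
  refine ⟨LamShift.expandRel, LamShift.expandRel_isProgramBisimulation,
    ⟨fun _ _ h => h.elim, fun _ _ h => h.elim⟩, ⟨?_, ?_⟩, ?_⟩
  · exact LamShift.Tm.Closed.absList ht (hxs ▸ Finset.subset_union_left)
  · refine LamShift.Tm.Closed.absList ?_ (hxs ▸ Finset.subset_union_right)
    rw [LamShift.Tm.capture_app_fvar ht hk, LamShift.Tm.lift_of_lcAt ht le_rfl]
    exact ⟨Nat.one_pos, LamShift.Tm.LCAt.mono ht (Nat.zero_le 1)⟩
  · rw [LamShift.Tm.capture_app_fvar ht hk]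
    exact LamShift.expands_absList xs t
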